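/- Let $\mathbb{T}=\mathbb{R}/\mathbb{Z}$ be the circle with its Lebesgue measure $m$, normalized so that $m(\mathbb{T})=1$. For a complex Borel measure $\mu$ on $\mathbb{T}$ and $n\in\mathbb{Z}$ put $\widehat{\mu}(n)=\int_{\mathbb{T}} e^{-2\pi i n x}\,d\mu(x)$, and for $f\in L^1(\mathbb{T},m)$ put $\widehat{f}(n)=\int_{\mathbb{T}} f(x)e^{-2\pi i n x}\,dm(x)$. Theorem. Let $(\Omega(n))_{n\ge 1}$ be a non-increasing sequence of positive real numbers with $\Omega(n)\to 0$. Then for every $\varepsilon>0$ there exists a compact set $E\subset\mathbb{T}$ with $m(E)>1-\varepsilon$ such that both of the following hold. (i) There exists a non-negative function $f\in L^2(\mathbb{T},m)$, not almost everywhere equal to $0$ and vanishing outside $E$, such that $\sum_{n\in\mathbb{Z}}|\widehat{f}(n)|^r<\infty$ for every real $r>1$. (ii) If $\mu$ is a complex Borel measure on $\mathbb{T}$ supported in $E$ with $|\widehat{\mu}(n)|\le\Omega(n)$ for all $n=1,2,3,\ldots$, then $\mu=0$. -/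

import Mathlib

open MeasureTheory

namespace CircleMeasure

/-- The total variation of a complex measure is finite, so that bounded Borel functions are
integrable against it. -/
theorem isFiniteMeasure_variation {X : Type*} [MeasurableSpace X] (μ : ComplexMeasure X) :
    IsFiniteMeasure μ.variation := by
  have h : μ.variation ≤
      (ComplexMeasure.re μ).totalVariation + (ComplexMeasure.im μ).totalVariation := by
    apply VectorMeasure.variation_le_of_forall_enorm_le
    intro s _
    have h1 : ‖μ s‖ₑ ≤ ‖(ComplexMeasure.re μ) s‖ₑ + ‖(ComplexMeasure.im μ) s‖ₑ := by
      have h2 : ‖μ s‖ ≤ ‖(ComplexMeasure.re μ) s‖ + ‖(ComplexMeasure.im μ) s‖ :=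
        Complex.norm_le_abs_re_add_abs_im (μ s)
      rw [← ofReal_norm, ← ofReal_norm, ← ofReal_norm,
        ← ENNReal.ofReal_add (norm_nonneg _) (norm_nonneg _)]
      exact ENNReal.ofReal_le_ofReal h2
    exact h1.trans (add_le_add (SignedMeasure.enorm_le_totalVariation _ s)
      (SignedMeasure.enorm_le_totalVariation _ s))
  exact isFiniteMeasure_of_le _ h

/-- The `n`-th Fourier coefficient `∫ conj (ζ ^ n) dμ(ζ)` of a complex Borel measure `μ` on the
circle `𝕋 = ℝ / ℤ`, where `ζ ^ n` is the character `x ↦ exp (2 π i n x)`. -/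
noncomputable def fourierCoeff (μ : ComplexMeasure UnitAddCircle) (n : ℤ) : ℂ :=
  μ.integral (fun x : UnitAddCircle => fourier (-n) x) (ContinuousLinearMap.mul ℝ ℂ)

/-- `μ` is carried by `E`: it vanishes on every Borel set disjoint from `E`. For closed `E` this
says that the closed support of `μ` is contained in `E`. -/
def SupportedOn (μ : ComplexMeasure UnitAddCircle) (E : Set UnitAddCircle) : Prop :=
  ∀ A : Set UnitAddCircle, MeasurableSet A → Disjoint A E → μ A = 0

end CircleMeasure

/-! ### Integration against complex measures and uniqueness of Fourier coefficients. -/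

namespace CircleMeasure

/-! Take widths `s k = c / 2 ^ k` and let `E` be the set of `x` for which every `N k • x` stays
outside the arc `‖·‖ < s k`, where the integers `N k` are chosen large one after another.

Uniqueness: for each `k` there is an analytic `1 + ∑_{n ≥ 1} q k n z ^ n` with absolutely summable
coefficients, of modulus at most `1 / (k + 1)` on the circle off the arc
(`exists_analytic_small_off_arc`). Its dilate by `N k` is small on `E`, so integrating it against
`μ`, times a character, gives at most the total variation over `k + 1`. Expanded, the same integral
is `μ̂ j` plus multiples of `μ̂ (j + n N k)` with `n ≥ 1`. For `k ≥ |j|` these frequencies are at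
least `N k - k > 0`; since `N k` is chosen after `q k`, the bound by `Ω` makes their contribution at
most `1 / (k + 1)`. Hence `μ̂ j = 0` for every `j`. Analyticity is what lets a bound on positive
frequencies suffice.

The function: `f = ∏ (1 - ψ k (N k • x))`, with `ψ k` equal to `1` on the arc and `0` off the arc
four times as wide (`exists_plateau`). The coefficients of `ψ k` are at most `6 s k` with sum at
most `2`, so their `ℓ^p` norm is `O(s k ^ ((p - 1) / p))`, summable in `k` for each `p > 1`. Sparse
dilations make `ℓ^p` norms of products almost multiplicative, uniformly in `p ≥ 1`
(`exists_dilations`), so the partial products stay bounded in every `ℓ^p`, `p > 1`, and one `f`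
serves all exponents. It equals `1` off a set of measure at most `16 c`, whose complement lies in
`E`. -/

theorem integral_const_mul {X : Type*} [MeasurableSpace X] (μ : ComplexMeasure X) (c : ℂ)
    (f : X → ℂ) :
    μ.integral (fun x => c * f x) (ContinuousLinearMap.mul ℝ ℂ) =
      c * μ.integral f (ContinuousLinearMap.mul ℝ ℂ) := by
  have := setToFun_smul (𝕜 := ℂ)
    (MeasureTheory.dominatedFinMeasAdditive_cbmApplyMeasure μ (ContinuousLinearMap.mul ℝ ℂ))
    (fun c s x => mul_assoc c x (μ s)) c f
  exact this

/-- The variation of `μ` gives no mass to the complement of `E`, so a bound on `E` is an almost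
everywhere bound. -/
theorem norm_integral_le_of_supportedOn {μ : ComplexMeasure UnitAddCircle} {E : Set UnitAddCircle}
    (hE : MeasurableSet E) (hμ : SupportedOn μ E) {h : UnitAddCircle → ℂ} {C : ℝ}
    (hC : ∀ x ∈ E, ‖h x‖ ≤ C) :
    ‖μ.integral h (ContinuousLinearMap.mul ℝ ℂ)‖ ≤ C * μ.variation.real Set.univ := by
  have := isFiniteMeasure_variation μ
  have h0 : μ.variation Eᶜ = 0 := by
    rw [VectorMeasure.variation_apply_eq_zero hE.compl]
    intro t ht htm
    exact hμ t htm (Set.disjoint_left.2 fun x hx hxE => ht hx hxE)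
  have h1 : ∀ᵐ x ∂μ.variation, ‖h x‖ ≤ C := by
    rw [ae_iff]
    refine measure_mono_null ?_ h0
    intro x hx hxE
    exact hx (hC x hxE)
  have h2 := VectorMeasure.norm_integral_le_of_norm_le_const (B := ContinuousLinearMap.mul ℝ ℂ) h1
  rwa [ContinuousLinearMap.opNorm_mul, mul_one] at h2

/-- Integration against a complex measure, as a functional on continuous functions. -/
noncomputable def integralCLM (μ : ComplexMeasure UnitAddCircle) : C(UnitAddCircle, ℂ) →L[ℂ] ℂ :=
  haveI := isFiniteMeasure_variation μ
  LinearMap.mkContinuous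
    { toFun := fun g => μ.integral (fun x => g x) (ContinuousLinearMap.mul ℝ ℂ)
      map_add' := fun f g => VectorMeasure.integral_fun_add
        (f.continuous.integrable_of_hasCompactSupport (HasCompactSupport.of_compactSpace _))
        (g.continuous.integrable_of_hasCompactSupport (HasCompactSupport.of_compactSpace _))
      map_smul' := fun c g => integral_const_mul μ c g }
    (μ.variation.real Set.univ) (fun g => by
      rw [mul_comm]
      exact norm_integral_le_of_supportedOn (E := Set.univ) MeasurableSet.univ
        (fun A _ hA => by rw [Set.disjoint_univ] at hA; simp [hA]) (fun x _ => g.norm_coe_le_norm x))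

theorem integralCLM_apply (μ : ComplexMeasure UnitAddCircle) (g : C(UnitAddCircle, ℂ)) :
    integralCLM μ g = μ.integral (fun x => g x) (ContinuousLinearMap.mul ℝ ℂ) := rfl

theorem integralCLM_fourier (μ : ComplexMeasure UnitAddCircle) (n : ℤ) :
    integralCLM μ (fourier n) = fourierCoeff μ (-n) := by
  rw [integralCLM_apply, fourierCoeff, neg_neg]

/-- The indicator of a closed set is a bounded pointwise limit of continuous functions, so dominated
convergence applies. -/
theorem apply_eq_zero_of_isClosed {μ : ComplexMeasure UnitAddCircle} (h : integralCLM μ = 0)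
    {F : Set UnitAddCircle} (hF : IsClosed F) : μ F = 0 := by
  have := isFiniteMeasure_variation μ
  have hpos : ∀ n : ℕ, 0 < 1 / ((n : ℝ) + 1) := fun n => by positivity
  let G : ℕ → UnitAddCircle → ℂ := fun n x => ((thickenedIndicator (hpos n) F x : NNReal) : ℂ)
  have hGc : ∀ n, Continuous (G n) := fun n =>
    Complex.continuous_ofReal.comp
      (NNReal.continuous_coe.comp (thickenedIndicator (hpos n) F).continuous)
  have hlim : ∀ x, Filter.Tendsto (fun n => G n x) Filter.atTop
      (nhds (F.indicator (fun _ => (1 : ℂ)) x)) := by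
    intro x
    have := thickenedIndicator_tendsto_indicator_closure hpos
      tendsto_one_div_add_atTop_nhds_zero_nat F
    rw [tendsto_pi_nhds] at this
    have h2 := (Complex.continuous_ofReal.comp NNReal.continuous_coe).continuousAt.tendsto.comp
      (this x)
    rw [hF.closure_eq] at h2
    have h3 : (F.indicator (fun _ => (1 : ℂ)) x) =
        (Complex.ofReal ∘ NNReal.toReal) (F.indicator (fun _ => 1) x) := by
      by_cases hx : x ∈ F <;> simp [hx]
    rw [h3]
    exact h2
  have hconv := VectorMeasure.tendsto_integral_filter_of_norm_le_const (μ := μ)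
    (B := ContinuousLinearMap.mul ℝ ℂ) (l := Filter.atTop) (ι := ℕ)
    (f := F.indicator fun _ => (1 : ℂ))
    (Filter.Eventually.of_forall fun n => (hGc n).aestronglyMeasurable)
    ⟨1, Filter.Eventually.of_forall fun n => Filter.Eventually.of_forall fun x => by
      have : ((thickenedIndicator (hpos n) F x : NNReal) : ℝ) ≤ 1 := by
        exact_mod_cast thickenedIndicator_le_one (hpos n) F x
      simpa [G] using this⟩
    (Filter.Eventually.of_forall hlim)
  have hz : ∀ n, μ.integral (G n) (ContinuousLinearMap.mul ℝ ℂ) = 0 := fun n => by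
    have := integralCLM_apply μ ⟨G n, hGc n⟩
    rw [h] at this
    exact this.symm
  simp only [hz] at hconv
  have hi := tendsto_nhds_unique hconv tendsto_const_nhds
  rw [VectorMeasure.integral_eq_setToFun, setToFun_indicator_const _ hF.measurableSet
    (measure_ne_top _ _)] at hi
  change (1 : ℂ) * μ F = 0 at hi
  simpa using hi

/-- A complex measure on the circle is determined by its Fourier coefficients. -/
theorem eq_zero_of_fourierCoeff_eq_zero {μ : ComplexMeasure UnitAddCircle}
    (h : ∀ n, fourierCoeff μ n = 0) : μ = 0 := by
  have hL : integralCLM μ = 0 := by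
    have hle : (Submodule.span ℂ (Set.range (fourier (T := 1)))).topologicalClosure ≤
        LinearMap.ker (integralCLM μ : C(UnitAddCircle, ℂ) →ₗ[ℂ] ℂ) := by
      refine Submodule.topologicalClosure_minimal _ ?_ (integralCLM μ).isClosed_ker
      rw [Submodule.span_le]
      rintro _ ⟨n, rfl⟩
      change integralCLM μ (fourier n) = 0
      rw [integralCLM_fourier, h]
    rw [span_fourier_closure_eq_top] at hle
    ext g
    exact hle (Submodule.mem_top (x := g))
  exact VectorMeasure.ext_of_generateFrom _
    (fun s hs => (apply_eq_zero_of_isClosed hL hs).trans (by simp))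
    (BorelSpace.measurable_eq.trans borel_eq_generateFrom_isClosed) isPiSystem_isClosed
    ((apply_eq_zero_of_isClosed hL isClosed_univ).trans (by simp))

/-- If `h = ∑ q n • fourier (j - n * N)` is small on a carrier of `μ`, then `μ̂ (-j)` is controlled
by the coefficients of `μ` at the remaining frequencies. -/
theorem norm_fourierCoeff_le {μ : ComplexMeasure UnitAddCircle} {E : Set UnitAddCircle}
    (hE : MeasurableSet E) (hμ : SupportedOn μ E) {q : ℕ → ℂ} (hq : Summable fun n => ‖q n‖)
    (hq0 : q 0 = 1) {N : ℕ} {j : ℤ} {δ ω : ℝ}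
    (hδ : ∀ x ∈ E, ‖∑' n : ℕ, q n * fourier (-((n : ℤ) * N)) x‖ ≤ δ)
    (hω : ∀ n : ℕ, 1 ≤ n → ‖fourierCoeff μ (j + n * N)‖ ≤ ω) :
    ‖fourierCoeff μ j‖ ≤ δ * μ.variation.real Set.univ + ω * ∑' n, ‖q n‖ := by
  have hs : Summable fun n : ℕ => q n • (fourier (-(j + (n : ℤ) * N)) : C(UnitAddCircle, ℂ)) := by
    refine Summable.of_norm ?_
    simpa [norm_smul, fourier_norm] using hq
  have h1 := (integralCLM μ).hasSum hs.hasSum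
  simp only [map_smul, integralCLM_fourier, neg_neg, smul_eq_mul] at h1
  have hval : ∀ x, (∑' n : ℕ, q n • (fourier (-(j + (n : ℤ) * N)) : C(UnitAddCircle, ℂ))) x =
      fourier (-j) x * ∑' n : ℕ, q n * fourier (-((n : ℤ) * N)) x := by
    intro x
    have := (ContinuousMap.evalCLM ℂ x).map_tsum hs
    rw [← tsum_mul_left]
    refine this.trans (tsum_congr fun n => ?_)
    simp only [ContinuousMap.evalCLM_apply, ContinuousMap.smul_apply, smul_eq_mul]
    rw [neg_add, fourier_add]
    ring
  have hn : ‖integralCLM μ (∑' n : ℕ, q n • (fourier (-(j + (n : ℤ) * N))))‖ ≤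
      δ * μ.variation.real Set.univ := by
    rw [integralCLM_apply]
    refine norm_integral_le_of_supportedOn hE hμ fun x hx => ?_
    rw [hval, norm_mul]
    have : ‖(fourier (-j) x : ℂ)‖ = 1 := by rw [fourier_apply]; exact Circle.norm_coe _
    rw [this, one_mul]
    exact hδ x hx
  -- The term `n = 0` is `μ̂ j` itself, because `q 0 = 1`; all others have `n ≥ 1` and fall under
  -- `hω`.
  have h2 := h1.summable.tsum_eq_zero_add
  rw [h1.tsum_eq] at h2
  simp only [hq0, Nat.cast_zero, zero_mul, add_zero, one_mul] at h2
  have hω0 : 0 ≤ ω := (norm_nonneg _).trans (hω 1 le_rfl)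
  have hq1 : Summable fun n => ‖q (n + 1)‖ := (summable_nat_add_iff 1).2 hq
  have hb : ∀ n : ℕ, ‖q (n + 1) * fourierCoeff μ (j + ((n + 1 : ℕ) : ℤ) * N)‖ ≤
      ω * ‖q (n + 1)‖ := fun n => by
    rw [norm_mul, mul_comm]
    exact mul_le_mul_of_nonneg_right (hω _ (by omega)) (norm_nonneg _)
  have h3 : ‖∑' n : ℕ, q (n + 1) * fourierCoeff μ (j + ((n + 1 : ℕ) : ℤ) * N)‖ ≤
      ω * ∑' n, ‖q n‖ := by
    refine (tsum_of_norm_bounded (hq1.mul_left ω).hasSum hb).trans ?_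
    rw [tsum_mul_left, hq.tsum_eq_zero_add]
    exact mul_le_mul_of_nonneg_left (le_add_of_nonneg_left (norm_nonneg _)) hω0
  calc ‖fourierCoeff μ j‖ = ‖integralCLM μ (∑' n : ℕ, q n • (fourier (-(j + (n : ℤ) * N)))) -
        ∑' n : ℕ, q (n + 1) * fourierCoeff μ (j + ((n + 1 : ℕ) : ℤ) * N)‖ := by
        rw [h2]; congr 1; ring
    _ ≤ _ := (norm_sub_le _ _).trans (add_le_add hn h3)

end CircleMeasure

/-! ### Analytic functions small off an arc. -/

open Filter Topology in
/-- For every `s, δ > 0` there is a function analytic in the disc, with value `1` at the centre and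
absolutely summable coefficients, which is smaller than `δ` on the circle outside the arc
`‖x‖ < s`. -/
theorem exists_analytic_small_off_arc {s δ : ℝ} (hs : 0 < s) (hδ : 0 < δ) :
    ∃ q : ℕ → ℂ, (Summable fun n => ‖q n‖) ∧ q 0 = 1 ∧
      ∀ x : UnitAddCircle, s ≤ ‖x‖ → ‖∑' n : ℕ, q n * (fourier (-(n : ℤ)) x : ℂ)‖ ≤ δ := by
  -- `1 - z` vanishes on the circle only at `x = 0`, so compactness bounds it below off the arc.
  obtain ⟨c, hc, hcx⟩ : ∃ c : ℝ, 0 < c ∧ ∀ x : UnitAddCircle, s ≤ ‖x‖ →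
      c ≤ ‖1 - (fourier (-1) x : ℂ)‖ := by
    have hcl : IsCompact {x : UnitAddCircle | s ≤ ‖x‖} :=
      (isClosed_le continuous_const continuous_norm).isCompact
    by_cases hne : {x : UnitAddCircle | s ≤ ‖x‖}.Nonempty
    · obtain ⟨x₀, hx₀, hmin⟩ := hcl.exists_isMinOn hne
        (f := fun x => ‖1 - (fourier (-1) x : ℂ)‖) (by fun_prop)
      refine ⟨_, ?_, fun x hx => hmin hx⟩
      rw [norm_pos_iff, sub_ne_zero]
      intro h
      rw [fourier_neg, fourier_one] at h
      have h1 : AddCircle.toCircle x₀ = 1 := by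
        have := congrArg (starRingEnd ℂ) h
        simp at this
        exact Circle.ext (by simpa using this.symm)
      rw [← AddCircle.toCircle_zero (T := 1)] at h1
      have h2 := AddCircle.injective_toCircle one_ne_zero h1
      simp only [Set.mem_ofPred_eq, h2, norm_zero] at hx₀
      linarith
    · exact ⟨1, one_pos, fun x hx => (hne ⟨x, hx⟩).elim⟩
  -- The bound `c / 2` keeps `‖1 - ρ z‖ ≥ c / 2` off the arc; `c ^ 2 / 16` gives `1 - ρ ^ 2 ≤ 2 η ≤
  -- ‖1 - ρ z‖ ^ 2 / 2` there.
  set η : ℝ := min (1 / 2) (min (c / 2) (c ^ 2 / 16)) with hη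
  have hη0 : 0 < η := by positivity
  have hη1 : η ≤ 1 / 2 := min_le_left _ _
  have hη2 : η ≤ c / 2 := (min_le_right _ _).trans (min_le_left _ _)
  have hη3 : η ≤ c ^ 2 / 16 := (min_le_right _ _).trans (min_le_right _ _)
  set ρ : ℝ := 1 - η with hρ
  have hρ0 : 0 < ρ := by rw [hρ]; linarith
  set M : ℝ := 2 * |Real.log δ| with hM
  -- The exponent is `M` times `(1 + ρ z) / (1 - ρ z) - 1`. On the circle its real part is `M` times
  -- the Poisson kernel minus `1`: it vanishes at the centre and is near `-M` off the arc.
  let Q : ℂ → ℂ := fun z => Complex.exp (M * (2 * ρ * z / (1 - ρ * z)))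
  -- Since `ρ (1 + η) = 1 - η ^ 2 < 1`, `Q` is analytic beyond the unit circle, whence absolute
  -- summability of the coefficients.
  set R : NNReal := ⟨1 + η, by positivity⟩ with hR
  have hden : ∀ z : ℂ, ‖z‖ ≤ 1 + η → 1 - ρ * z ≠ 0 := by
    intro z hz h
    have h1 : (ρ : ℂ) * z = 1 := (sub_eq_zero.1 h).symm
    have h2 := congrArg norm h1
    rw [norm_mul, Complex.norm_real, Real.norm_of_nonneg hρ0.le, norm_one] at h2
    have h3 : ρ * ‖z‖ ≤ ρ * (1 + η) := mul_le_mul_of_nonneg_left hz hρ0.le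
    rw [h2, hρ] at h3
    nlinarith
  have hdiff : DifferentiableOn ℂ Q (Metric.closedBall 0 R) := by
    intro z hz
    have hz' : ‖z‖ ≤ 1 + η := mem_closedBall_zero_iff.1 hz
    have := hden z hz'
    apply DifferentiableAt.differentiableWithinAt
    fun_prop (disch := assumption)
  have hRpos : 0 < R := by
    rw [← NNReal.coe_pos, hR]
    change 0 < 1 + η
    positivity
  have hps := hdiff.hasFPowerSeriesOnBall hRpos
  set p := cauchyPowerSeries Q 0 R
  have hmem : ∀ z : ℂ, ‖z‖ = 1 → z ∈ Metric.eball (0 : ℂ) R := by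
    intro z hz
    rw [Metric.mem_eball, edist_zero_right, ← enorm_norm, hz]
    have : (1 : NNReal) < R := by
      rw [← NNReal.coe_lt_coe, hR]
      change (1 : ℝ) < 1 + η
      linarith
    simpa using this
  refine ⟨p.coeff, ?_, ?_, fun x hx => ?_⟩
  · have := p.summable_norm_apply (x := 1)
      (Metric.eball_subset_eball hps.r_le (hmem 1 norm_one))
    exact this
  · have := hps.coeff_zero (fun _ => 0)
    rw [FormalMultilinearSeries.coeff]
    convert this using 1
    · congr 1
      exact Subsingleton.elim _ _
    · simp [Q]
  · set z : ℂ := fourier (-1) x with hz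
    have hz1 : ‖z‖ = 1 := by rw [hz, fourier_apply]; exact Circle.norm_coe _
    have hsum := hps.hasSum (hmem z hz1)
    have hterm : ∀ n : ℕ, p.coeff n * (fourier (-(n : ℤ)) x : ℂ) = p n fun _ => z := by
      intro n
      rw [FormalMultilinearSeries.apply_eq_pow_smul_coeff, smul_eq_mul, mul_comm, hz]
      congr 1
      rw [fourier_apply, fourier_apply, ← Circle.coe_pow, ← AddCircle.toCircle_nsmul]
      congr 2
      simp
    simp only [hterm, hsum.tsum_eq, zero_add, Q]
    rw [Complex.norm_exp]
    set d : ℂ := 1 - ρ * z with hd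
    have hd0 : d ≠ 0 := hden z (by rw [hz1]; linarith)
    have hdn : c / 2 ≤ ‖d‖ := by
      have h1 : (1 - z) = d - η * z := by rw [hd, hρ]; push_cast; ring
      have h2 := norm_sub_le d (η * z)
      rw [← h1, norm_mul, hz1, Complex.norm_real, Real.norm_of_nonneg hη0.le, mul_one] at h2
      have := hcx x hx
      rw [← hz] at this
      linarith
    have hsq : c ^ 2 / 4 ≤ Complex.normSq d := by
      rw [Complex.normSq_eq_norm_sq]
      nlinarith
    -- Follows from `‖1 - d‖ = ρ`. It gives `Re (2 / d - 2) = (1 - ρ ^ 2) / ‖d‖ ^ 2 - 1 ≤ -1 / 2`,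
    -- and `M / 2 = |log δ|`.
    have hre : 2 * d.re = 1 - ρ ^ 2 + Complex.normSq d := by
      have h1 : Complex.normSq (1 - d) = ρ ^ 2 := by
        have : 1 - d = ρ * z := by rw [hd]; ring
        rw [this, Complex.normSq_eq_norm_sq, norm_mul, hz1, Complex.norm_real,
          Real.norm_of_nonneg hρ0.le, mul_one]
      rw [Complex.normSq_apply] at h1 ⊢
      simp only [Complex.sub_re, Complex.one_re, Complex.sub_im, Complex.one_im] at h1
      linarith
    have hw : (M : ℂ) * (2 * ρ * z / d) = ((M : ℝ) : ℂ) * (((2 : ℝ) : ℂ) * d⁻¹ - ((2 : ℝ) : ℂ)) := by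
      have : (ρ : ℂ) * z = 1 - d := by rw [hd]; ring
      rw [mul_assoc 2, this]
      field_simp
      push_cast
      ring
    have hnpos : 0 < Complex.normSq d := Complex.normSq_pos.2 hd0
    have hre2 : ((M : ℂ) * (2 * ρ * z / d)).re ≤ M * (-1 / 2) := by
      rw [hw, Complex.re_ofReal_mul, Complex.sub_re, Complex.re_ofReal_mul, Complex.ofReal_re,
        Complex.inv_re, ← mul_div_assoc, hre]
      refine mul_le_mul_of_nonneg_left ?_ (by positivity)
      rw [sub_le_iff_le_add, div_le_iff₀ hnpos, hρ]
      nlinarith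
    calc Real.exp _ ≤ Real.exp (Real.log δ) := by
          refine Real.exp_le_exp.2 (hre2.trans ?_)
          rw [hM]
          linarith [neg_abs_le (Real.log δ)]
      _ = δ := Real.exp_log hδ

/-! ### Fourier coefficients on the circle and plateau functions. -/

theorem haarAddCircle_eq_volume : (AddCircle.haarAddCircle : Measure UnitAddCircle) = volume := by
  rw [AddCircle.volume_eq_smul_haarAddCircle, ENNReal.ofReal_one, one_smul]

theorem haarAddCircle_real_closedBall_le {s : ℝ} (hs : 0 ≤ s) :
    (AddCircle.haarAddCircle : Measure UnitAddCircle).real (Metric.closedBall 0 s) ≤ 2 * s := by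
  rw [haarAddCircle_eq_volume, Measure.real, AddCircle.volume_closedBall]
  exact ENNReal.toReal_le_of_le_ofReal (by positivity) (ENNReal.ofReal_le_ofReal (min_le_right _ _))

theorem haarAddCircle_real_closedBall {s : ℝ} (hs : 0 ≤ s) (hs' : s ≤ 1 / 2) :
    (AddCircle.haarAddCircle : Measure UnitAddCircle).real (Metric.closedBall 0 s) = 2 * s := by
  rw [haarAddCircle_eq_volume, Measure.real, AddCircle.volume_closedBall, min_eq_right (by linarith),
    ENNReal.toReal_ofReal (by positivity)]

theorem MeasureTheory.MemLp.hasSum_sq_fourierCoeff {g : UnitAddCircle → ℂ}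
    (hg : MemLp g 2 (AddCircle.haarAddCircle : Measure UnitAddCircle)) :
    HasSum (fun i => ‖fourierCoeff g i‖ ^ 2) (∫ t : UnitAddCircle, ‖g t‖ ^ 2 ∂AddCircle.haarAddCircle) := by
  have h := _root_.hasSum_sq_fourierCoeff (hg.toLp g)
  rw [fourierCoeff_congr_ae hg.coeFn_toLp] at h
  convert h using 1
  refine integral_congr_ae ?_
  filter_upwards [hg.coeFn_toLp] with x hx
  rw [hx]

theorem norm_fourierCoeff_le_integral (g : UnitAddCircle → ℂ) (n : ℤ) :
    ‖fourierCoeff g n‖ ≤ ∫ t : UnitAddCircle, ‖g t‖ ∂AddCircle.haarAddCircle := by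
  refine (norm_integral_le_integral_norm _).trans (le_of_eq ?_)
  congr 1
  ext t
  rw [norm_smul, fourier_apply, Circle.norm_coe, one_mul]

theorem fourierCoeff_comp_sub (u : UnitAddCircle → ℂ) (t : UnitAddCircle) (n : ℤ) :
    fourierCoeff (fun x => u (x - t)) n = fourier (-n) t * fourierCoeff u n := by
  have h := integral_sub_right_eq_self (μ := (AddCircle.haarAddCircle : Measure UnitAddCircle))
    (fun x => fourier (-n) (x + t) • u x) t
  simp only [sub_add_cancel] at h
  rw [fourierCoeff, h, fourierCoeff, ← integral_const_mul]
  congr 1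
  ext x
  simp only [fourier_apply, smul_add, AddCircle.toCircle_add, Circle.coe_mul, smul_eq_mul]
  ring

/-- Fourier coefficients of the average of the translates of `u` over a set. -/
theorem fourierCoeff_setIntegral_comp_sub {u : UnitAddCircle → ℂ} (hu : Continuous u)
    {B : Set UnitAddCircle} (hB : MeasurableSet B) (n : ℤ) :
    fourierCoeff (fun x => ∫ t in B, u (x - t) ∂AddCircle.haarAddCircle) n =
      fourierCoeff u n * fourierCoeff (B.indicator fun _ => (1 : ℂ)) n := by
  have hint : Integrable (Function.uncurry fun x t : UnitAddCircle => fourier (-n) x • u (x - t))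
      ((AddCircle.haarAddCircle : Measure UnitAddCircle).prod
        ((AddCircle.haarAddCircle : Measure UnitAddCircle).restrict B)) := by
    have hc : Continuous (Function.uncurry
        fun x t : UnitAddCircle => fourier (-n) x • u (x - t)) := by
      unfold Function.uncurry
      fun_prop
    exact hc.integrable_of_hasCompactSupport (HasCompactSupport.of_compactSpace _)
  calc fourierCoeff (fun x => ∫ t in B, u (x - t) ∂AddCircle.haarAddCircle) n
      = ∫ x, ∫ t in B, fourier (-n) x • u (x - t) ∂AddCircle.haarAddCircle ∂AddCircle.haarAddCircle := by
        rw [fourierCoeff]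
        simp_rw [integral_smul]
    _ = ∫ t in B, ∫ x, fourier (-n) x • u (x - t) ∂AddCircle.haarAddCircle ∂AddCircle.haarAddCircle :=
        integral_integral_swap hint
    _ = ∫ t in B, fourier (-n) t * fourierCoeff u n ∂AddCircle.haarAddCircle := by
        congr 1
        ext t
        exact fourierCoeff_comp_sub u t n
    _ = _ := by
        rw [integral_mul_const, mul_comm, ← integral_indicator hB]
        congr 1
        refine integral_congr_ae (Filter.Eventually.of_forall fun t => ?_)
        by_cases ht : t ∈ B <;> simp [ht]

/-- A plateau function at scale `s`, with absolutely summable Fourier coefficients whose sum is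
bounded independently of `s`. -/
theorem exists_plateau {s : ℝ} (hs : 0 < s) (hs' : s ≤ 1 / 2) :
    ∃ ψ : UnitAddCircle → ℝ, Continuous ψ ∧ (∀ x, 0 ≤ ψ x) ∧ (∀ x, ψ x ≤ 1) ∧
      (∀ x, ‖x‖ ≤ s → ψ x = 1) ∧ (∀ x, 4 * s < ‖x‖ → ψ x = 0) ∧
      (∀ n, ‖fourierCoeff (fun x => (ψ x : ℂ)) n‖ ≤ 6 * s) ∧
      (Summable fun n => ‖fourierCoeff (fun x => (ψ x : ℂ)) n‖) ∧
      ∑' n, ‖fourierCoeff (fun x => (ψ x : ℂ)) n‖ ≤ 2 := by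
  -- A trapezoid, `1` up to radius `2 s` and `0` from `3 s` on. Averaging over radius `s` costs `s`
  -- on each side, giving the radii `s` and `4 s`; being a convolution of two `L²` functions, the
  -- average has summable coefficients.
  let u : UnitAddCircle → ℝ := fun x => max 0 (min 1 (3 - ‖x‖ / s))
  have huc : Continuous u := by fun_prop
  have hu0 : ∀ x, 0 ≤ u x := fun x => le_max_left _ _
  have hu1 : ∀ x, u x ≤ 1 := fun x => max_le zero_le_one (min_le_left _ _)
  have hu_one : ∀ x, ‖x‖ ≤ 2 * s → u x = 1 := fun x hx => by
    have : ‖x‖ / s ≤ 2 := by rwa [div_le_iff₀ hs]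
    simp only [u]
    rw [min_eq_left (by linarith), max_eq_right zero_le_one]
  have hu_zero : ∀ x, 3 * s ≤ ‖x‖ → u x = 0 := fun x hx => by
    have : 3 ≤ ‖x‖ / s := by rwa [le_div_iff₀ hs]
    simp only [u]
    exact max_eq_left ((min_le_right _ _).trans (by linarith))
  set H : Measure UnitAddCircle := AddCircle.haarAddCircle with hH
  set B : Set UnitAddCircle := Metric.closedBall 0 s with hB
  have hBm : MeasurableSet B := measurableSet_closedBall
  have hb : H.real B = 2 * s := haarAddCircle_real_closedBall hs.le hs'
  have hui : ∀ x, IntegrableOn (fun t => u (x - t)) B H := fun x =>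
    (Continuous.integrable_of_hasCompactSupport (by fun_prop)
      (HasCompactSupport.of_compactSpace _)).integrableOn
  let ψ : UnitAddCircle → ℝ := fun x => (2 * s)⁻¹ * ∫ t in B, u (x - t) ∂H
  have hconst : ∀ c : ℝ, ∫ _ in B, c ∂H = 2 * s * c := fun c => by
    rw [setIntegral_const, hb, smul_eq_mul]
  have hbound : ∀ x, u x ≤ (Metric.closedBall (0 : UnitAddCircle) (3 * s)).indicator 1 x := by
    intro x
    by_cases hx : ‖x‖ ≤ 3 * s
    · rw [Set.indicator_of_mem (by simpa using hx)]
      exact hu1 x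
    · rw [Set.indicator_of_notMem (by simpa using hx), hu_zero x (not_le.1 hx).le]
  have hintu : ∫ x, u x ∂H ≤ 6 * s := by
    have h1 : ∫ x, u x ∂H ≤
        ∫ x, (Metric.closedBall (0 : UnitAddCircle) (3 * s)).indicator 1 x ∂H :=
      integral_mono (huc.integrable_of_hasCompactSupport (HasCompactSupport.of_compactSpace _))
        ((integrable_const (1 : ℝ)).indicator measurableSet_closedBall) hbound
    rw [integral_indicator_one measurableSet_closedBall] at h1
    have h2 := haarAddCircle_real_closedBall_le (s := 3 * s) (by positivity)
    linarith
  have hψc : Continuous ψ := by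
    refine continuous_const.mul ?_
    refine continuous_of_dominated (bound := fun _ => 1)
      (fun x => (hui x).aestronglyMeasurable) (fun x => ?_) (integrable_const _) ?_
    · refine Filter.Eventually.of_forall fun t => ?_
      rw [Real.norm_of_nonneg (hu0 _)]
      exact hu1 _
    · exact Filter.Eventually.of_forall fun t => by fun_prop
  have hU : MemLp (fun x => (u x : ℂ)) 2 H :=
    (Continuous.memLp_of_hasCompactSupport (by fun_prop) (HasCompactSupport.of_compactSpace _))
  have hV : MemLp (B.indicator fun _ => (1 : ℂ)) 2 H := (memLp_const 1).indicator hBm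
  have hUs := hU.hasSum_sq_fourierCoeff
  have hVs := hV.hasSum_sq_fourierCoeff
  set U := fourierCoeff fun x => (u x : ℂ)
  set V := fourierCoeff (B.indicator fun _ => (1 : ℂ))
  have hUint : ∫ x, ‖(u x : ℂ)‖ ^ 2 ∂H ≤ 6 * s := by
    refine le_trans (integral_mono ?_ ?_ fun x => ?_) hintu
    · exact Continuous.integrable_of_hasCompactSupport (by fun_prop)
        (HasCompactSupport.of_compactSpace _)
    · exact huc.integrable_of_hasCompactSupport (HasCompactSupport.of_compactSpace _)
    · simp only [Complex.norm_real, Real.norm_of_nonneg (hu0 x)]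
      nlinarith [hu0 x, hu1 x]
  have hVint : ∀ r : ℕ, r ≠ 0 → ∫ x, ‖B.indicator (fun _ => (1 : ℂ)) x‖ ^ r ∂H = 2 * s := by
    intro r hr
    rw [← hb, ← integral_indicator_one hBm]
    congr 1
    ext x
    by_cases hx : x ∈ B <;> simp [hx, hr]
  have hcoeff : ∀ n, fourierCoeff (fun x => (ψ x : ℂ)) n = ((2 * s : ℝ) : ℂ)⁻¹ * (U n * V n) := by
    intro n
    rw [← fourierCoeff_setIntegral_comp_sub (by fun_prop) hBm, ← fourierCoeff.const_mul]
    congr 1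
    ext x
    simp only [ψ, Complex.ofReal_mul, Complex.ofReal_inv]
    rw [← integral_complex_ofReal]
  have hnorm : ∀ n, ‖fourierCoeff (fun x => (ψ x : ℂ)) n‖ = (2 * s)⁻¹ * (‖U n‖ * ‖V n‖) := by
    intro n
    rw [hcoeff, norm_mul, norm_mul, norm_inv, Complex.norm_real, Real.norm_of_nonneg (by positivity)]
  -- With Parseval, this sums to at most `(6 s + 2 s) / 2 / (2 s) = 2`, free of `s`.
  have hle : ∀ n, ‖fourierCoeff (fun x => (ψ x : ℂ)) n‖ ≤
      (2 * s)⁻¹ * ((‖U n‖ ^ 2 + ‖V n‖ ^ 2) / 2) := by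
    intro n
    rw [hnorm]
    refine mul_le_mul_of_nonneg_left ?_ (by positivity)
    nlinarith [sq_nonneg (‖U n‖ - ‖V n‖)]
  have hsum := ((hUs.add hVs).div_const 2).mul_left (2 * s)⁻¹
  have hsummable : Summable fun n => ‖fourierCoeff (fun x => (ψ x : ℂ)) n‖ :=
    Summable.of_nonneg_of_le (fun _ => norm_nonneg _) hle hsum.summable
  refine ⟨ψ, hψc, fun x => ?_, fun x => ?_, fun x hx => ?_, fun x hx => ?_, fun n => ?_,
    hsummable, ?_⟩
  · exact mul_nonneg (by positivity) (integral_nonneg fun t => hu0 _)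
  · have h1 : ∫ t in B, u (x - t) ∂H ≤ ∫ _ in B, (1 : ℝ) ∂H :=
      integral_mono (hui x) (integrable_const _) fun t => hu1 _
    rw [hconst, mul_one] at h1
    calc ψ x ≤ (2 * s)⁻¹ * (2 * s) := mul_le_mul_of_nonneg_left h1 (by positivity)
      _ = 1 := inv_mul_cancel₀ (by positivity)
  · have h1 : ∫ t in B, u (x - t) ∂H = ∫ _ in B, (1 : ℝ) ∂H := by
      refine setIntegral_congr_fun hBm fun t ht => hu_one _ ?_
      have : ‖t‖ ≤ s := by simpa [hB] using ht
      linarith [norm_sub_le x t]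
    simp only [ψ, h1, hconst, mul_one]
    exact inv_mul_cancel₀ (by positivity)
  · have h1 : ∫ t in B, u (x - t) ∂H = ∫ _ in B, (0 : ℝ) ∂H := by
      refine setIntegral_congr_fun hBm fun t ht => hu_zero _ ?_
      have : ‖t‖ ≤ s := by simpa [hB] using ht
      linarith [norm_sub_norm_le x t]
    simp only [ψ, h1, integral_zero, mul_zero]
  · have h1 : ‖U n‖ ≤ 6 * s := by
      refine (norm_fourierCoeff_le_integral _ n).trans (le_trans (le_of_eq ?_) hintu)
      congr 1
      ext x
      rw [Complex.norm_real, Real.norm_of_nonneg (hu0 x)]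
    have h2 : ‖V n‖ ≤ 2 * s := by
      refine (norm_fourierCoeff_le_integral _ n).trans (le_of_eq ?_)
      rw [← hVint 1 one_ne_zero]
      simp [hH]
    rw [hnorm]
    calc (2 * s)⁻¹ * (‖U n‖ * ‖V n‖) ≤ (2 * s)⁻¹ * (6 * s * (2 * s)) := by gcongr
      _ = 6 * s := by field_simp
  · refine (hsummable.tsum_le_tsum hle hsum.summable).trans ?_
    rw [hsum.tsum_eq, ← hH, hVint 2 two_ne_zero, inv_mul_le_iff₀ (by positivity)]
    linarith

/-! ### `ℓ^p` norms of dilated convolutions. -/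

section SequenceNorms

open ENNReal

theorem eLpNorm'_count (c : ℤ → ℂ) (p : ℝ) :
    eLpNorm' c p Measure.count = (∑' n, ‖c n‖ₑ ^ p) ^ (1 / p) := by
  rw [eLpNorm', lintegral_count]

theorem tsum_rpow_le_rpow_tsum {ι : Type*} (a : ι → ℝ≥0∞) {p : ℝ} (hp : 1 ≤ p) :
    ∑' n, a n ^ p ≤ (∑' n, a n) ^ p := by
  have hsplit : ∀ x : ℝ≥0∞, x ^ p = x * x ^ (p - 1) := fun x => by
    conv_lhs => rw [← add_sub_cancel 1 p]
    rw [ENNReal.rpow_add_of_nonneg _ _ zero_le_one (by linarith), ENNReal.rpow_one]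
  calc ∑' n, a n ^ p = ∑' n, a n * a n ^ (p - 1) := by simp_rw [hsplit]
    _ ≤ ∑' n, a n * (∑' m, a m) ^ (p - 1) := ENNReal.tsum_le_tsum fun n =>
        mul_le_mul_right (ENNReal.rpow_le_rpow (ENNReal.le_tsum n) (by linarith)) _
    _ = _ := by rw [ENNReal.tsum_mul_right, hsplit]

theorem eLpNorm'_count_le_tsum (c : ℤ → ℂ) {p : ℝ} (hp : 1 ≤ p) :
    eLpNorm' c p Measure.count ≤ ∑' n, ‖c n‖ₑ := by
  rw [eLpNorm'_count, one_div, ENNReal.rpow_inv_le_iff (by linarith)]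
  exact tsum_rpow_le_rpow_tsum _ hp

/-- Convolution of `c` with the sequence `a` placed on the multiples of `N`. -/
noncomputable def dilatedConv (N : ℕ) (a c : ℤ → ℂ) (l : ℤ) : ℂ := ∑' m : ℤ, a m * c (l - N * m)

/-- Each shift by `N m` preserves the sum over `l`. The case `p = 1` is Young's inequality; general
`p` serves non-overlapping blocks. -/
theorem tsum_enorm_shift (N : ℕ) (a c : ℤ → ℂ) {p : ℝ} (hp : 0 ≤ p) :
    ∑' l : ℤ, ∑' m : ℤ, ‖a m * c (l - N * m)‖ₑ ^ p =
      (∑' l, ‖c l‖ₑ ^ p) * ∑' m, ‖a m‖ₑ ^ p := by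
  rw [ENNReal.tsum_comm, mul_comm, ← ENNReal.tsum_mul_right]
  refine tsum_congr fun m => ?_
  simp_rw [enorm_mul, ENNReal.mul_rpow_of_nonneg _ _ hp]
  rw [ENNReal.tsum_mul_left]
  congr 1
  exact (Equiv.subRight ((N : ℤ) * m)).tsum_eq fun l => ‖c l‖ₑ ^ p

theorem tsum_enorm_dilatedConv_le (N : ℕ) (a c : ℤ → ℂ) :
    ∑' l, ‖dilatedConv N a c l‖ₑ ≤ (∑' l, ‖c l‖ₑ) * ∑' m, ‖a m‖ₑ := by
  have := tsum_enorm_shift N a c zero_le_one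
  simp only [ENNReal.rpow_one] at this
  rw [← this]
  exact ENNReal.tsum_le_tsum fun l => enorm_tsum_le_tsum_enorm

/-- Translates of a block of radius `D` by distinct multiples of `N > 2 D` are disjoint, so at most
one term of the convolution is nonzero at each `l`. -/
theorem eLpNorm'_dilatedConv_le_of_support {N D : ℕ} (hN : 2 * D < N) {a c : ℤ → ℂ}
    (hc : ∀ n : ℤ, (D : ℤ) < |n| → c n = 0) {p : ℝ} (hp : 0 < p) :
    eLpNorm' (dilatedConv N a c) p Measure.count ≤
      eLpNorm' c p Measure.count * eLpNorm' a p Measure.count := by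
  rw [eLpNorm'_count, eLpNorm'_count, eLpNorm'_count, ← ENNReal.mul_rpow_of_nonneg _ _ (by positivity),
    ← tsum_enorm_shift N a c hp.le]
  refine ENNReal.rpow_le_rpow (ENNReal.tsum_le_tsum fun l => ?_) (by positivity)
  by_cases h : ∃ m : ℤ, c (l - N * m) ≠ 0
  · obtain ⟨m, hm⟩ := h
    have huniq : ∀ m' : ℤ, m' ≠ m → a m' * c (l - N * m') = 0 := by
      intro m' hne
      rw [hc, mul_zero]
      have h1 : |l - N * m| ≤ D := not_lt.1 fun h => hm (hc _ h)
      by_contra! h2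
      have h3 : |(N : ℤ) * (m - m')| ≤ 2 * D := by
        have : (N : ℤ) * (m - m') = (l - N * m') - (l - N * m) := by ring
        rw [this]
        linarith [abs_sub (l - (N : ℤ) * m') (l - N * m)]
      rw [abs_mul, Nat.abs_cast] at h3
      have h4 : 1 ≤ |m - m'| := Int.one_le_abs (sub_ne_zero.2 hne.symm)
      have h5 : (2 * D : ℤ) < N := by exact_mod_cast hN
      nlinarith
    rw [dilatedConv, tsum_eq_single m huniq]
    exact ENNReal.le_tsum (f := fun m : ℤ => ‖a m * c (l - N * m)‖ₑ ^ p) m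
  · push Not at h
    simp [dilatedConv, h, hp]

theorem tsum_enorm_ne_top_iff {ι : Type*} {c : ι → ℂ} :
    ∑' n, ‖c n‖ₑ ≠ ∞ ↔ Summable fun n => ‖c n‖ := by
  have : ∀ n, ‖c n‖ₑ = ((‖c n‖₊ : NNReal) : ℝ≥0∞) := fun n => rfl
  simp_rw [this]
  rw [ENNReal.tsum_coe_ne_top_iff_summable, ← NNReal.summable_coe]
  rfl

theorem summable_mul_dilated {N : ℕ} {a c : ℤ → ℂ} (ha : Summable fun n => ‖a n‖)
    (hc : Summable fun n => ‖c n‖) (l : ℤ) : Summable fun m : ℤ => a m * c (l - N * m) := by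
  refine Summable.of_norm_bounded (ha.mul_right (∑' n, ‖c n‖)) fun m => ?_
  rw [norm_mul]
  exact mul_le_mul_of_nonneg_left (hc.le_tsum _ fun _ _ => norm_nonneg _) (norm_nonneg _)

/-- For large dilations the `ℓ^p` norm is almost multiplicative, uniformly in `p ≥ 1`. -/
theorem exists_eLpNorm'_dilatedConv_le {a c : ℤ → ℂ} (ha : Summable fun n => ‖a n‖)
    (hc : Summable fun n => ‖c n‖) {η : ℝ≥0∞} (hη : η ≠ 0) :
    ∃ N₀ : ℕ, ∀ N ≥ N₀, ∀ p : ℝ, 1 ≤ p →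
      eLpNorm' (dilatedConv N a c) p Measure.count ≤
        eLpNorm' c p Measure.count * eLpNorm' a p Measure.count + η := by
  -- Truncate `c` at `D`: the head falls under the disjoint case, and the tail is controlled in
  -- `ℓ¹`, which dominates every `ℓ^p`. Hence `D` does not depend on `p`.
  obtain ⟨D, hD⟩ : ∃ D : ℕ, (∑' n : ℤ, ‖{n : ℤ | (D : ℤ) < |n|}.indicator c n‖ₑ) *
      ∑' m, ‖a m‖ₑ ≤ η := by
    have hA : ∑' m, ‖a m‖ₑ ≠ ∞ := tsum_enorm_ne_top_iff.2 ha
    have hC : ∑' m, ‖c m‖ₑ ≠ ∞ := tsum_enorm_ne_top_iff.2 hc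
    have hlim := ENNReal.tendsto_tsum_compl_atTop_zero hC
    have hlim2 := ENNReal.Tendsto.mul_const hlim (Or.inr hA)
    rw [zero_mul] at hlim2
    obtain ⟨S, hS⟩ := ((tendsto_order.1 hlim2).2 η (pos_iff_ne_zero.2 hη)).exists
    obtain ⟨D, hD⟩ : ∃ D : ℕ, ∀ n ∈ S, |n| ≤ (D : ℤ) :=
      ⟨S.sup fun n => n.natAbs, fun n hn => by
        rw [Int.abs_eq_natAbs]
        exact_mod_cast Finset.le_sup (f := fun n : ℤ => n.natAbs) hn⟩
    refine ⟨D, le_trans (mul_le_mul_left ?_ _) hS.le⟩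
    change _ ≤ ∑' b : ↥({n : ℤ | n ∉ S}), ‖c b‖ₑ
    rw [tsum_subtype {n : ℤ | n ∉ S} (fun n => ‖c n‖ₑ)]
    refine ENNReal.tsum_le_tsum fun n => ?_
    by_cases hn : (D : ℤ) < |n|
    · have : n ∉ S := fun h => absurd (hD n h) (not_le.2 hn)
      simp [Set.indicator, hn, this]
    · simp [Set.indicator, hn]
  refine ⟨2 * D + 1, fun N hN p hp => ?_⟩
  set T : Set ℤ := {n : ℤ | (D : ℤ) < |n|}
  have hc1 : Summable fun n => ‖Tᶜ.indicator c n‖ :=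
    Summable.of_nonneg_of_le (fun _ => norm_nonneg _) (fun n => norm_indicator_le_norm_self c n) hc
  have hc2 : Summable fun n => ‖T.indicator c n‖ :=
    Summable.of_nonneg_of_le (fun _ => norm_nonneg _) (fun n => norm_indicator_le_norm_self c n) hc
  have hsplit : dilatedConv N a c =
      dilatedConv N a (Tᶜ.indicator c) + dilatedConv N a (T.indicator c) := by
    ext l
    rw [Pi.add_apply, dilatedConv, dilatedConv, dilatedConv,
      ← (summable_mul_dilated ha hc1 l).tsum_add (summable_mul_dilated ha hc2 l)]
    refine tsum_congr fun m => ?_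
    rw [← mul_add, ← Pi.add_apply, Set.indicator_compl_add_self]
  rw [hsplit]
  refine (eLpNorm'_add_le (Measurable.of_discrete).aestronglyMeasurable
    (Measurable.of_discrete).aestronglyMeasurable hp).trans (add_le_add ?_ ?_)
  · refine (eLpNorm'_dilatedConv_le_of_support (D := D) (by omega) (fun n hn => ?_)
      (by linarith)).trans (mul_le_mul_left ?_ _)
    · have : n ∉ Tᶜ := fun h => h hn
      simp [this]
    · exact eLpNorm'_mono_enorm_ae (by linarith) (Filter.Eventually.of_forall fun n =>
        enorm_indicator_le_enorm_self c n)
  · exact ((eLpNorm'_count_le_tsum _ hp).trans (tsum_enorm_dilatedConv_le N a _)).trans hD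

end SequenceNorms

/-- Fourier coefficients of `g · φ(N ·)`. -/
theorem fourierCoeff_mul_comp_nsmul {g φ : UnitAddCircle → ℂ} (hg : Continuous g)
    (hφ : Continuous φ) (hs : Summable fun n => ‖fourierCoeff φ n‖) (N : ℕ) (l : ℤ) :
    fourierCoeff (fun x => g x * φ (N • x)) l =
      dilatedConv N (fourierCoeff φ) (fourierCoeff g) l := by
  have hgb : ∃ C, ∀ x, ‖g x‖ ≤ C := by
    obtain ⟨C, hC⟩ := isCompact_univ.exists_bound_of_continuousOn hg.continuousOn
    exact ⟨C, fun x => hC x (Set.mem_univ x)⟩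
  obtain ⟨C, hC⟩ := hgb
  have hpt : ∀ x, HasSum (fun m : ℤ => fourierCoeff φ m * (fourier (-(l - N * m)) x * g x))
      (fourier (-l) x * (g x * φ (N • x))) := by
    intro x
    have h := has_pointwise_sum_fourier_series_of_summable (f := ⟨φ, hφ⟩) hs.of_norm (N • x)
    have h2 : HasSum (fun m => (fourier (-l) x * g x) * (fourierCoeff φ m • (fourier m (N • x) : ℂ)))
        ((fourier (-l) x * g x) * φ (N • x)) := h.mul_left _
    rw [mul_assoc] at h2
    refine h2.congr_fun fun m => ?_
    have : (fourier m (N • x) : ℂ) = fourier (N * m) x := by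
      rw [fourier_apply, fourier_apply, mul_comm, mul_smul, natCast_zsmul]
    rw [this, neg_sub, sub_eq_add_neg, add_comm, fourier_add, smul_eq_mul]
    ring
  have hnorm : ∀ (n : ℤ) (x : UnitAddCircle), ‖(fourier n x : ℂ)‖ = 1 := fun n x => by
    rw [fourier_apply]; exact Circle.norm_coe _
  have hsum := hasSum_integral_of_dominated_convergence
    (μ := (AddCircle.haarAddCircle : Measure UnitAddCircle))
    (F := fun (m : ℤ) x => fourierCoeff φ m * (fourier (-(l - N * m)) x * g x))
    (f := fun x => fourier (-l) x * (g x * φ (N • x)))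
    (fun m _ => ‖fourierCoeff φ m‖ * C)
    (fun m => (Continuous.aestronglyMeasurable (by fun_prop)))
    (fun m => Filter.Eventually.of_forall fun x => by
      rw [norm_mul, norm_mul, hnorm, one_mul]
      exact mul_le_mul_of_nonneg_left (hC x) (norm_nonneg _))
    (Filter.Eventually.of_forall fun x => hs.mul_right C)
    (integrable_const _)
    (Filter.Eventually.of_forall hpt)
  rw [dilatedConv]
  refine Eq.trans ?_ (hsum.tsum_eq.symm.trans (tsum_congr fun m => ?_))
  · rfl
  · rw [integral_const_mul]
    rfl

/-! ### Riesz products with uniformly bounded `ℓ^p` norms. -/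

section Products

open ENNReal Finset

theorem fourierCoeff_one_sub {ψ : UnitAddCircle → ℂ} (hψ : Continuous ψ) :
    fourierCoeff (fun x => 1 - ψ x) = Pi.single 0 1 - fourierCoeff ψ := by
  have h1 : fourierCoeff (fun _ : UnitAddCircle => (1 : ℂ)) = Pi.single 0 1 := by
    rw [← fourierCoeff_fourier (T := 1) 0]
    congr 1
    ext x
    exact fourier_zero.symm
  have h2 := fourierCoeff.add (f := fun _ : UnitAddCircle => (1 : ℂ)) (g := (-1 : ℂ) • ψ)
    (integrable_const _)
    (Continuous.integrable_of_hasCompactSupport (by fun_prop) (HasCompactSupport.of_compactSpace _))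
  ext n
  have h3 := congrFun h2 n
  rw [Pi.add_apply, fourierCoeff.const_smul, h1] at h3
  rw [Pi.sub_apply, sub_eq_add_neg, ← neg_one_smul ℂ, ← h3]
  congr 1
  ext x
  simp [sub_eq_add_neg]

theorem summable_norm_fourierCoeff_one_sub {ψ : UnitAddCircle → ℂ} (hψ : Continuous ψ)
    (hs : Summable fun n => ‖fourierCoeff ψ n‖) :
    Summable fun n => ‖fourierCoeff (fun x => 1 - ψ x) n‖ := by
  rw [fourierCoeff_one_sub hψ]
  refine Summable.of_nonneg_of_le (fun _ => norm_nonneg _) (fun n => norm_sub_le _ _)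
    (Summable.add ?_ hs)
  exact summable_of_ne_finset_zero (s := {0}) fun n hn => by
    rw [Pi.single_eq_of_ne (by simpa using hn), norm_zero]

theorem eLpNorm'_single_zero_one {p : ℝ} (hp : 0 < p) :
    eLpNorm' (Pi.single 0 1 : ℤ → ℂ) p Measure.count = 1 := by
  rw [eLpNorm'_count, tsum_eq_single 0 fun n hn => by
    rw [Pi.single_eq_of_ne hn, enorm_zero, ENNReal.zero_rpow_of_pos hp]]
  simp

/-- Interpolation between the supremum and `ℓ¹`: `‖c n‖ ^ p ≤ A ^ (p - 1) * ‖c n‖`. -/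
theorem eLpNorm'_count_le_of_norm_le {c : ℤ → ℂ} {A S p : ℝ} (hp : 1 ≤ p)
    (hA : ∀ n, ‖c n‖ ≤ A) (hc : Summable fun n => ‖c n‖) (hS : ∑' n, ‖c n‖ ≤ S) :
    eLpNorm' c p Measure.count ≤ ENNReal.ofReal ((A ^ (p - 1) * S) ^ (1 / p)) := by
  have hA0 : 0 ≤ A := (norm_nonneg _).trans (hA 0)
  have hS0 : 0 ≤ S := (tsum_nonneg fun _ => norm_nonneg _).trans hS
  rw [eLpNorm'_count, ← ENNReal.ofReal_rpow_of_nonneg (by positivity) (by positivity)]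
  refine ENNReal.rpow_le_rpow ?_ (by positivity)
  have hle : ∀ n, ‖c n‖ ^ p ≤ A ^ (p - 1) * ‖c n‖ := fun n => by
    have : ‖c n‖ ^ p = ‖c n‖ ^ (p - 1) * ‖c n‖ := by
      rw [← Real.rpow_add_one' (norm_nonneg _) (by linarith), sub_add_cancel]
    rw [this]
    exact mul_le_mul_of_nonneg_right
      (Real.rpow_le_rpow (norm_nonneg _) (hA n) (by linarith)) (norm_nonneg _)
  calc ∑' n, ‖c n‖ₑ ^ p = ∑' n, ENNReal.ofReal (‖c n‖ ^ p) := by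
        refine tsum_congr fun n => ?_
        rw [← ofReal_norm, ENNReal.ofReal_rpow_of_nonneg (norm_nonneg _) (by linarith)]
    _ ≤ ∑' n, ENNReal.ofReal (A ^ (p - 1) * ‖c n‖) :=
        ENNReal.tsum_le_tsum fun n => ENNReal.ofReal_le_ofReal (hle n)
    _ = ENNReal.ofReal (∑' n, A ^ (p - 1) * ‖c n‖) :=
        (ENNReal.ofReal_tsum_of_nonneg (fun n => by positivity) (hc.mul_left _)).symm
    _ ≤ _ := by
        rw [tsum_mul_left]
        exact ENNReal.ofReal_le_ofReal (mul_le_mul_of_nonneg_left hS (by positivity))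

theorem eLpNorm'_fourierCoeff_one_sub_le {ψ : UnitAddCircle → ℂ} (hψ : Continuous ψ)
    {A S p : ℝ} (hp : 1 ≤ p) (hA : ∀ n, ‖fourierCoeff ψ n‖ ≤ A)
    (hc : Summable fun n => ‖fourierCoeff ψ n‖) (hS : ∑' n, ‖fourierCoeff ψ n‖ ≤ S) :
    eLpNorm' (fourierCoeff fun x => 1 - ψ x) p Measure.count ≤
      1 + ENNReal.ofReal ((A ^ (p - 1) * S) ^ (1 / p)) := by
  rw [fourierCoeff_one_sub hψ, sub_eq_add_neg]
  refine (eLpNorm'_add_le Measurable.of_discrete.aestronglyMeasurable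
    Measurable.of_discrete.aestronglyMeasurable hp).trans ?_
  rw [eLpNorm'_single_zero_one (by linarith), eLpNorm'_neg]
  exact add_le_add le_rfl (eLpNorm'_count_le_of_norm_le hp hA hc hS)

theorem summable_norm_fourierCoeff_mul {g φ : UnitAddCircle → ℂ} (hg : Continuous g)
    (hφ : Continuous φ) (hgs : Summable fun n => ‖fourierCoeff g n‖)
    (hs : Summable fun n => ‖fourierCoeff φ n‖) (N : ℕ) :
    Summable fun n => ‖fourierCoeff (fun x => g x * φ (N • x)) n‖ := by
  rw [← tsum_enorm_ne_top_iff]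
  simp_rw [fourierCoeff_mul_comp_nsmul hg hφ hs N]
  exact ((tsum_enorm_dilatedConv_le N _ _).trans_lt (ENNReal.mul_lt_top
    (tsum_enorm_ne_top_iff.2 hgs).lt_top (tsum_enorm_ne_top_iff.2 hs).lt_top)).ne

/-- Riesz products: sufficiently sparse dilations of the factors make the `ℓ^p` norms of the
Fourier coefficients of all partial products almost multiplicative. -/
theorem exists_dilations {φ : ℕ → UnitAddCircle → ℂ} (hφ : ∀ k, Continuous (φ k))
    (hs : ∀ k, Summable fun n => ‖fourierCoeff (φ k) n‖) {P : ℕ → ℕ → Prop}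
    (hP : ∀ k, ∀ᶠ N in Filter.atTop, P k N) :
    ∃ N : ℕ → ℕ, (∀ k, P k (N k)) ∧ ∀ (K : ℕ) (p : ℝ), 1 ≤ p →
      eLpNorm' (fourierCoeff fun x => ∏ k ∈ range K, φ k (N k • x)) p Measure.count ≤
        (1 + ∑ k ∈ range K, (2⁻¹ : ℝ≥0∞) ^ k) *
          ∏ k ∈ range K, max 1 (eLpNorm' (fourierCoeff (φ k)) p Measure.count) := by
  have step : ∀ (k : ℕ) (g : {g : UnitAddCircle → ℂ //
      Continuous g ∧ Summable fun n => ‖fourierCoeff g n‖}), ∃ N : ℕ, P k N ∧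
      ∀ p : ℝ, 1 ≤ p →
        eLpNorm' (fourierCoeff fun x => g.1 x * φ k (N • x)) p Measure.count ≤
          eLpNorm' (fourierCoeff g.1) p Measure.count *
            eLpNorm' (fourierCoeff (φ k)) p Measure.count + 2⁻¹ ^ k := by
    rintro k ⟨g, hg, hgs⟩
    obtain ⟨N₀, hN₀⟩ := exists_eLpNorm'_dilatedConv_le (hs k) hgs
      (η := 2⁻¹ ^ k) (pow_ne_zero _ (by simp))
    obtain ⟨N, hN, hN'⟩ := ((hP k).and (Filter.eventually_ge_atTop N₀)).exists
    refine ⟨N, hN, fun p hp => ?_⟩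
    have : (fourierCoeff fun x => g x * φ k (N • x)) =
        dilatedConv N (fourierCoeff (φ k)) (fourierCoeff g) :=
      funext fun l => fourierCoeff_mul_comp_nsmul hg (hφ k) (hs k) N l
    simp only [this]
    exact hN₀ N hN' p hp
  choose ν hνP hν using step
  have hone : (fourierCoeff fun _ : UnitAddCircle => (1 : ℂ)) = Pi.single 0 1 := by
    have h := fourierCoeff_one_sub (ψ := fun _ => 0) continuous_const
    simp only [sub_zero] at h
    rw [h]
    ext n
    simp [fourierCoeff]
  -- The partial products are built recursively, since each dilation depends on the product already
  -- formed; continuity and summability are carried along.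
  let G : ℕ → {g : UnitAddCircle → ℂ // Continuous g ∧ Summable fun n => ‖fourierCoeff g n‖} :=
    fun K => Nat.rec ⟨fun _ => 1, continuous_const, by
      have h := summable_norm_fourierCoeff_one_sub (ψ := fun _ => 0) continuous_const
        (by simp [fourierCoeff, summable_zero])
      simpa using h⟩
      (fun k g => ⟨fun x => g.1 x * φ k (ν k g • x),
        g.2.1.mul ((hφ k).comp (continuous_nsmul _)),
        summable_norm_fourierCoeff_mul g.2.1 (hφ k) g.2.2 (hs k) _⟩) K
  have hG : ∀ K x, (G K).1 x = ∏ k ∈ range K, φ k (ν k (G k) • x) := by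
    intro K
    induction K with
    | zero => intro x; simp [G]
    | succ K ih =>
      intro x
      rw [prod_range_succ, ← ih]
  refine ⟨fun k => ν k (G k), fun k => hνP k _, fun K p hp => ?_⟩
  have hGK : ∀ K, (fun x => ∏ k ∈ range K, φ k (ν k (G k) • x)) = (G K).1 :=
    fun K => funext fun x => (hG K x).symm
  rw [hGK]
  induction K with
  | zero =>
    have : (G 0).1 = fun _ => 1 := rfl
    rw [this, hone, eLpNorm'_single_zero_one (by linarith)]
    simp
  | succ K ih =>
    have h1 := hν K (G K) p hp
    set R := ∏ k ∈ range K, max 1 (eLpNorm' (fourierCoeff (φ k)) p Measure.count)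
    set b := eLpNorm' (fourierCoeff (φ K)) p Measure.count
    -- The maxima with `1` keep this product at least `1`, so the additive error `2⁻¹ ^ K` is
    -- absorbed into the prefactor.
    have hR : 1 ≤ R * max 1 b := by
      rw [← prod_range_succ fun k => max 1 (eLpNorm' (fourierCoeff (φ k)) p Measure.count)]
      exact Finset.one_le_prod' fun k _ => le_max_left _ _
    rw [prod_range_succ, sum_range_succ, ← add_assoc, add_mul]
    calc _ ≤ eLpNorm' (fourierCoeff (G K).1) p Measure.count * b + 2⁻¹ ^ K := h1
      _ ≤ (1 + ∑ k ∈ range K, (2⁻¹ : ℝ≥0∞) ^ k) * R * max 1 b + 2⁻¹ ^ K * 1 := by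
          rw [mul_one]
          gcongr
          exact le_max_right _ _
      _ ≤ _ := by
          rw [mul_assoc]
          gcongr

theorem prod_max_one_le {b : ℕ → ℝ≥0∞} {β : ℕ → ℝ} (hβ : ∀ k, 0 ≤ β k) (hs : Summable β)
    (hb : ∀ k, b k ≤ 1 + ENNReal.ofReal (β k)) (K : ℕ) :
    ∏ k ∈ range K, max 1 (b k) ≤ ENNReal.ofReal (Real.exp (∑' k, β k)) := by
  calc ∏ k ∈ range K, max 1 (b k) ≤ ∏ k ∈ range K, ENNReal.ofReal (Real.exp (β k)) := by
        refine Finset.prod_le_prod' fun k _ => ?_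
        have : 1 + ENNReal.ofReal (β k) ≤ ENNReal.ofReal (Real.exp (β k)) := by
          rw [← ENNReal.ofReal_one, ← ENNReal.ofReal_add zero_le_one (hβ k), add_comm]
          exact ENNReal.ofReal_le_ofReal (Real.add_one_le_exp _)
        exact max_le (le_self_add.trans this) ((hb k).trans this)
    _ = ENNReal.ofReal (Real.exp (∑ k ∈ range K, β k)) := by
        rw [Real.exp_sum, ENNReal.ofReal_prod_of_nonneg fun _ _ => (Real.exp_pos _).le]
    _ ≤ _ := ENNReal.ofReal_le_ofReal (Real.exp_le_exp.2 (hs.sum_le_tsum _ fun k _ => hβ k))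

/-- A geometric series of ratio `2 ^ (-(p - 1) / p)`, which is below `1` precisely because `p > 1`.
-/
theorem summable_geometric_rpow {c S p : ℝ} (hc : 0 ≤ c) (hS : 0 ≤ S) (hp : 1 < p) :
    Summable fun k : ℕ => ((c * (1 / 2) ^ k) ^ (p - 1) * S) ^ (1 / p) := by
  have h : ∀ k : ℕ, ((c * (1 / 2) ^ k) ^ (p - 1) * S) ^ (1 / p) =
      (c ^ (p - 1) * S) ^ (1 / p) * (((1 / 2 : ℝ) ^ (p - 1)) ^ (1 / p)) ^ k := by
    intro k
    rw [Real.mul_rpow hc (by positivity), mul_right_comm,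
      Real.mul_rpow (by positivity) (by positivity)]
    congr 1
    simp only [← Real.rpow_natCast, ← Real.rpow_mul (by norm_num : (0 : ℝ) ≤ 1 / 2)]
    congr 1
    ring
  simp_rw [h]
  refine (summable_geometric_of_lt_one (by positivity) ?_).mul_left _
  exact Real.rpow_lt_one (by positivity)
    (Real.rpow_lt_one (by norm_num) (by norm_num) (by linarith)) (by positivity)

/-- Bounds on the `ℓ^r` norms of Fourier coefficients survive bounded pointwise limits. -/
theorem summable_rpow_fourierCoeff_of_tendsto {F : ℕ → UnitAddCircle → ℂ} {f : UnitAddCircle → ℂ}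
    (hF : ∀ K, Continuous (F K)) (hb : ∀ K x, ‖F K x‖ ≤ 1)
    (hlim : ∀ x, Filter.Tendsto (fun K => F K x) Filter.atTop (nhds (f x)))
    {r : ℝ} (hr : 0 < r) {C : ℝ≥0∞} (hC : C ≠ ∞)
    (hFC : ∀ K, eLpNorm' (fourierCoeff (F K)) r Measure.count ≤ C) :
    Summable fun n : ℤ => ‖fourierCoeff f n‖ ^ r := by
  have hcoeff : ∀ n, Filter.Tendsto (fun K => fourierCoeff (F K) n) Filter.atTop
      (nhds (fourierCoeff f n)) := by
    intro n
    refine tendsto_integral_of_dominated_convergence (fun _ => 1)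
      (fun K => Continuous.aestronglyMeasurable (by fun_prop)) (integrable_const _)
      (fun K => Filter.Eventually.of_forall fun x => ?_)
      (Filter.Eventually.of_forall fun x => (hlim x).const_smul _)
    rw [norm_smul, fourier_apply, Circle.norm_coe, one_mul]
    exact hb K x
  -- Fatou's lemma for counting measure on `ℤ`.
  have h1 := Lp.eLpNorm'_lim_le_liminf_eLpNorm' (μ := (Measure.count : Measure ℤ)) hr
    (fun K => Measurable.of_discrete.aestronglyMeasurable)
    (Filter.Eventually.of_forall hcoeff)
  have h2 : eLpNorm' (fourierCoeff f) r Measure.count ≤ C :=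
    h1.trans (Filter.liminf_le_of_le (by isBoundedDefault) fun b hb =>
      hb.exists.elim fun K hK => hK.trans (hFC K))
  have h3 : ∑' n, ‖fourierCoeff f n‖ₑ ^ r ≠ ∞ := by
    intro h
    rw [eLpNorm'_count, h, ENNReal.top_rpow_of_pos (by positivity)] at h2
    exact hC (top_le_iff.1 h2)
  have h4 := ENNReal.summable_toReal h3
  refine h4.congr fun n => ?_
  rw [← ENNReal.toReal_rpow, toReal_enorm]

end Products

/-! ### The set `E` and the proof of the theorem. -/

theorem haarAddCircle_preimage_nsmul {N : ℕ} (hN : N ≠ 0) {A : Set UnitAddCircle}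
    (hA : MeasurableSet A) :
    (AddCircle.haarAddCircle : Measure UnitAddCircle) ((fun x => N • x) ⁻¹' A) =
      AddCircle.haarAddCircle A := by
  have h := Measure.measurePreserving_zsmul (AddCircle.haarAddCircle : Measure UnitAddCircle)
    (n := (N : ℤ)) (by exact_mod_cast hN)
  simp only [natCast_zsmul] at h
  exact h.measure_preimage hA.nullMeasurableSet

/-- A complex measure whose positive Fourier coefficients are dominated by `Ω` vanishes if it is
carried by a set on which suitable dilated analytic functions are uniformly small. -/
theorem CircleMeasure.eq_zero_of_small_on {Ω : ℕ → ℝ}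
    (hΩ : ∀ m n : ℕ, 1 ≤ m → m ≤ n → Ω n ≤ Ω m) {E : Set UnitAddCircle} (hE : MeasurableSet E)
    {q : ℕ → ℕ → ℂ} (hq : ∀ k, Summable fun n => ‖q k n‖) (hq0 : ∀ k, q k 0 = 1) {N : ℕ → ℕ}
    (hN : ∀ k, k < N k) (hΩN : ∀ k, Ω (N k - k) * ∑' n, ‖q k n‖ ≤ 1 / ((k : ℝ) + 1))
    (hsmall : ∀ k, ∀ x ∈ E,
      ‖∑' n : ℕ, q k n * (fourier (-(n : ℤ)) (N k • x) : ℂ)‖ ≤ 1 / ((k : ℝ) + 1))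
    {μ : ComplexMeasure UnitAddCircle} (hμ : SupportedOn μ E)
    (hμΩ : ∀ n : ℕ, 1 ≤ n → ‖CircleMeasure.fourierCoeff μ (n : ℤ)‖ ≤ Ω n) : μ = 0 := by
  refine eq_zero_of_fourierCoeff_eq_zero fun j => ?_
  set V := μ.variation.real Set.univ
  have hbound : ∀ k : ℕ, j.natAbs ≤ k →
      ‖CircleMeasure.fourierCoeff μ j‖ ≤ 1 / ((k : ℝ) + 1) * (V + 1) := by
    intro k hk
    have hNk := hN k
    have h := norm_fourierCoeff_le (j := j) (N := N k) (δ := 1 / ((k : ℝ) + 1))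
      (ω := Ω (N k - k)) hE hμ (hq k) (hq0 k) (fun x hx => ?_) fun n hn => ?_
    · calc _ ≤ _ := h
        _ ≤ 1 / ((k : ℝ) + 1) * V + 1 / ((k : ℝ) + 1) := by linarith [hΩN k]
        _ = _ := by ring
    · convert hsmall k x hx using 5 with n
      rw [fourier_apply, fourier_apply, ← natCast_zsmul, smul_smul]
      congr 3
      ring
    -- With `|j| ≤ k < N k` and `n ≥ 1`, the frequency `j + n N k` is at least `N k - k ≥ 1`, so
    -- monotonicity of `Ω` applies.
    · have h1 : (N k : ℤ) ≤ n * N k := by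
        have : (1 : ℤ) ≤ n := by exact_mod_cast hn
        nlinarith
      obtain ⟨m, hm⟩ := Int.eq_ofNat_of_zero_le (a := j + n * N k) (by omega)
      rw [hm]
      exact (hμΩ m (by omega)).trans (hΩ _ _ (by omega) (by omega))
  have hlim : Filter.Tendsto (fun k : ℕ => 1 / ((k : ℝ) + 1) * (V + 1)) Filter.atTop (nhds 0) := by
    simpa using tendsto_one_div_add_atTop_nhds_zero_nat.mul_const (V + 1)
  refine norm_le_zero_iff.1 (ge_of_tendsto hlim ?_)
  filter_upwards [Filter.eventually_ge_atTop j.natAbs] with k hk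
  exact hbound k hk

theorem mainTheorem2 (Ω : ℕ → ℝ)
    (hΩ_pos : ∀ n : ℕ, 1 ≤ n → 0 < Ω n)
    (hΩ_anti : ∀ m n : ℕ, 1 ≤ m → m ≤ n → Ω n ≤ Ω m)
    (hΩ_lim : Filter.Tendsto Ω Filter.atTop (nhds 0))
    (ε : ℝ) (hε : 0 < ε) :
    ∃ E : Set UnitAddCircle,
      IsCompact E ∧
      1 - ε < (AddCircle.haarAddCircle : Measure UnitAddCircle).real E ∧
      (∃ f : UnitAddCircle → ℝ,
        MemLp f 2 (AddCircle.haarAddCircle : Measure UnitAddCircle) ∧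
        (∀ x, 0 ≤ f x) ∧
        (∀ x, x ∉ E → f x = 0) ∧
        ¬ (f =ᵐ[(AddCircle.haarAddCircle : Measure UnitAddCircle)] 0) ∧
        ∀ r : ℝ, 1 < r →
          Summable (fun n : ℤ => ‖fourierCoeff (fun x : UnitAddCircle => (f x : ℂ)) n‖ ^ r)) ∧
      (∀ μ : ComplexMeasure UnitAddCircle,
        CircleMeasure.SupportedOn μ E →
        (∀ n : ℕ, 1 ≤ n → ‖CircleMeasure.fourierCoeff μ (n : ℤ)‖ ≤ Ω n) →
        μ = 0) := by
  -- The exceptional set has measure at most `∑ 8 s k = 16 c`: at most `ε / 2` makes `E` large, at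
  -- most `1 / 2` keeps `f` from vanishing almost everywhere.
  set c : ℝ := min ε 1 / 32 with hc
  have hc0 : 0 < c := by positivity
  have hcε : 16 * c ≤ ε / 2 := by rw [hc]; linarith [min_le_left ε 1]
  have hc1 : 16 * c ≤ 1 / 2 := by rw [hc]; linarith [min_le_right ε 1]
  set s : ℕ → ℝ := fun k => c * (1 / 2) ^ k with hs
  have hs0 : ∀ k, 0 < s k := fun k => by positivity
  have hsc : ∀ k, s k ≤ c := fun k =>
    mul_le_of_le_one_right hc0.le (pow_le_one₀ (by norm_num) (by norm_num))
  choose q hq hq0 hqs using fun k : ℕ =>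
    exists_analytic_small_off_arc (hs0 k) (show 0 < 1 / ((k : ℝ) + 1) by positivity)
  choose ψ hψc hψ0 hψ1 hψone hψzero hψA hψs hψS using fun k : ℕ =>
    exists_plateau (hs0 k) (by linarith [hsc k])
  have hψc' : ∀ k, Continuous fun x => (ψ k x : ℂ) := fun k =>
    Complex.continuous_ofReal.comp (hψc k)
  have hP : ∀ k : ℕ, ∀ᶠ N : ℕ in Filter.atTop,
      k < N ∧ Ω (N - k) * ∑' n, ‖q k n‖ ≤ 1 / ((k : ℝ) + 1) := by
    intro k
    have h1 : Filter.Tendsto (fun N : ℕ => Ω (N - k) * ∑' n, ‖q k n‖) Filter.atTop (nhds 0) := by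
      simpa using (hΩ_lim.comp (Filter.tendsto_sub_atTop_nat k)).mul_const (∑' n, ‖q k n‖)
    exact (Filter.eventually_gt_atTop k).and (h1.eventually_le_const (by positivity))
  obtain ⟨N, hN, hnorm⟩ := exists_dilations (φ := fun k x => 1 - (ψ k x : ℂ))
    (fun k => continuous_const.sub (hψc' k))
    (fun k => summable_norm_fourierCoeff_one_sub (hψc' k) (hψs k)) hP
  set E : Set UnitAddCircle := {x | ∀ k, s k ≤ ‖N k • x‖} with hE
  have hEc : IsClosed E := by
    rw [hE, Set.ofPred_forall]
    exact isClosed_iInter fun k => isClosed_le continuous_const (by fun_prop)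
  -- Off `Z` every `ψ k (N k • x)` vanishes, so all factors of the product equal `1`.
  set Z : Set UnitAddCircle :=
    ⋃ k, (fun x : UnitAddCircle => N k • x) ⁻¹' Metric.closedBall 0 (4 * s k) with hZ
  have hZm : MeasurableSet Z := MeasurableSet.iUnion fun k =>
    (Metric.isClosed_closedBall.preimage (continuous_nsmul (N k))).measurableSet
  have hnotZ : ∀ x, x ∉ Z → ∀ k, 4 * s k < ‖N k • x‖ := by
    intro x hx k
    by_contra! h
    exact hx (Set.mem_iUnion.2 ⟨k, by simpa using h⟩)
  have hZμ : (AddCircle.haarAddCircle : Measure UnitAddCircle).real Z ≤ 16 * c := by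
    refine ENNReal.toReal_le_of_le_ofReal (by positivity) ((measure_iUnion_le _).trans ?_)
    have hgeom : HasSum (fun k => 8 * s k) (16 * c) := by
      have := (hasSum_geometric_two.mul_left c).mul_left 8
      rwa [show 8 * (c * 2) = 16 * c by ring] at this
    rw [← hgeom.tsum_eq, ENNReal.ofReal_tsum_of_nonneg (fun k => by positivity) hgeom.summable]
    refine ENNReal.tsum_le_tsum fun k => ?_
    rw [haarAddCircle_preimage_nsmul (by have := (hN k).1; omega) measurableSet_closedBall,
      ENNReal.le_ofReal_iff_toReal_le (measure_ne_top _ _) (by positivity)]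
    have := haarAddCircle_real_closedBall_le (s := 4 * s k) (by positivity)
    exact this.trans (by linarith)
  have hZc : (AddCircle.haarAddCircle : Measure UnitAddCircle).real Zᶜ =
      1 - (AddCircle.haarAddCircle : Measure UnitAddCircle).real Z :=
    probReal_compl_eq_one_sub hZm
  have hZE : Zᶜ ⊆ E := fun x hx k => by linarith [hnotZ x hx k, hs0 k]
  let F : ℕ → UnitAddCircle → ℝ := fun K x => ∏ k ∈ Finset.range K, (1 - ψ k (N k • x))
  have hF0 : ∀ K x, 0 ≤ F K x := fun K x =>
    Finset.prod_nonneg fun k _ => sub_nonneg.2 (hψ1 k _)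
  have hF1 : ∀ K x, F K x ≤ 1 := fun K x =>
    Finset.prod_le_one (fun k _ => sub_nonneg.2 (hψ1 k _)) fun k _ => sub_le_self _ (hψ0 k _)
  have hFanti : ∀ x, Antitone fun K => F K x := fun x =>
    antitone_nat_of_succ_le fun K => by
      simp only [F, Finset.prod_range_succ]
      exact mul_le_of_le_one_right (hF0 K x) (sub_le_self _ (hψ0 K _))
  have hFc : ∀ K, Continuous (F K) := fun K => by
    refine continuous_finsetProd _ fun k _ => ?_
    exact continuous_const.sub ((hψc k).comp (continuous_nsmul _))
  have hbdd : ∀ x, BddBelow (Set.range fun K => F K x) := fun x =>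
    ⟨0, by rintro _ ⟨K, rfl⟩; exact hF0 K x⟩
  let f : UnitAddCircle → ℝ := fun x => ⨅ K, F K x
  have hlim : ∀ x, Filter.Tendsto (fun K => F K x) Filter.atTop (nhds (f x)) := fun x =>
    tendsto_atTop_ciInf (hFanti x) (hbdd x)
  have hf0 : ∀ x, 0 ≤ f x := fun x => le_ciInf fun K => hF0 K x
  have hf1 : ∀ x, f x ≤ 1 := fun x => (ciInf_le (hbdd x) 0).trans (hF1 0 x)
  have hfone : ∀ x, x ∉ Z → f x = 1 := by
    intro x hx
    refine tendsto_nhds_unique (hlim x) (tendsto_const_nhds.congr fun K => ?_)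
    refine (Finset.prod_eq_one fun k _ => ?_).symm
    rw [hψzero k _ (hnotZ x hx k), sub_zero]
  refine ⟨E, hEc.isCompact, ?_, ⟨f, ?_, hf0, fun x hx => ?_, fun hfz => ?_, fun r hr => ?_⟩,
    fun μ hμ hμΩ => ?_⟩
  · have : (AddCircle.haarAddCircle : Measure UnitAddCircle).real Zᶜ ≤
        (AddCircle.haarAddCircle : Measure UnitAddCircle).real E := measureReal_mono hZE
    linarith
  · have hfm : Measurable f := Measurable.iInf fun K => (hFc K).measurable
    refine MemLp.of_bound hfm.aestronglyMeasurable 1 (Filter.Eventually.of_forall fun x => ?_)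
    rw [Real.norm_of_nonneg (hf0 x)]
    exact hf1 x
  · obtain ⟨k, hk⟩ : ∃ k, ‖N k • x‖ < s k := by
      by_contra! h
      exact hx h
    -- The partial product must have `k + 1` factors to include the vanishing factor of index `k`.
    refine le_antisymm ((ciInf_le (hbdd x) (k + 1)).trans (le_of_eq ?_)) (hf0 x)
    refine Finset.prod_eq_zero (Finset.self_mem_range_succ k) ?_
    rw [hψone k _ hk.le, sub_self]
  · have h0 : (AddCircle.haarAddCircle : Measure UnitAddCircle) Zᶜ = 0 := by
      refine measure_mono_null (fun x hx => ?_) (ae_iff.1 hfz)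
      change ¬ f x = 0
      rw [hfone x hx]
      exact one_ne_zero
    have h1 : (AddCircle.haarAddCircle : Measure UnitAddCircle).real Zᶜ = 0 := by
      rw [Measure.real, h0, ENNReal.toReal_zero]
    linarith
  · have hβ : ∀ k, 0 ≤ ((6 * s k) ^ (r - 1) * 2) ^ (1 / r) := fun k => by
      have := (hs0 k).le
      positivity
    have hβs : Summable fun k => ((6 * s k) ^ (r - 1) * 2) ^ (1 / r) := by
      have := summable_geometric_rpow (c := 6 * c) (S := 2) (by positivity) zero_le_two hr
      simpa only [hs, mul_assoc] using this
    have hbound := fun K => (hnorm K r hr.le).trans (mul_le_mul'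
      (add_le_add_right (ENNReal.sum_le_tsum (Finset.range K)) 1)
      (prod_max_one_le hβ hβs (fun k => eLpNorm'_fourierCoeff_one_sub_le (hψc' k) hr.le
        (hψA k) (hψs k) (hψS k)) K))
    have hne : (1 + ∑' k : ℕ, (2⁻¹ : ENNReal) ^ k) *
        ENNReal.ofReal (Real.exp (∑' k, ((6 * s k) ^ (r - 1) * 2) ^ (1 / r))) ≠ ⊤ := by
      refine ENNReal.mul_ne_top ?_ ENNReal.ofReal_ne_top
      rw [ENNReal.tsum_geometric]
      norm_num
    refine summable_rpow_fourierCoeff_of_tendsto (F := fun K x => (F K x : ℂ))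
      (fun K => Complex.continuous_ofReal.comp (hFc K)) (fun K x => ?_)
      (fun x => (Complex.continuous_ofReal.tendsto _).comp (hlim x)) (by linarith) hne
      fun K => ?_
    · rw [Complex.norm_real, Real.norm_of_nonneg (hF0 K x)]
      exact hF1 K x
    · have hcast : (fun x => (F K x : ℂ)) =
          fun x => ∏ k ∈ Finset.range K, (1 - (ψ k (N k • x) : ℂ)) := by
        ext x
        simp [F]
      rw [hcast]
      exact hbound K
  · exact CircleMeasure.eq_zero_of_small_on hΩ_anti hEc.measurableSet hq hq0 (fun k => (hN k).1)
      (fun k => (hN k).2) (fun k x hx => hqs k _ (hx k)) hμ hμΩ
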